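/- Let $V$ be a Euclidean Jordan algebra, that is, a finite-dimensional real commutative (not necessarily associative) algebra with unit $e$ whose product $\circ$ satisfies the Jordan identity $(x\circ y)\circ(x\circ x)=x\circ(y\circ(x\circ x))$ and which admits a positive definite symmetric bilinear form $B$ with $B(x\circ y,z)=B(y,x\circ z)$ for all $x,y,z\in V$. Equip $V$ with the trace inner product $\langle x,y\rangle=\operatorname{tr}(x\circ y)$. Here $\operatorname{tr}(x)=\sum_i\lambda_i$ is the sum of the eigenvalues of $x$, where $x=\sum_i\lambda_i e_i$ is a spectral decomposition of $x$ in a Jordan frame $(e_1,\dots,e_n)$, i.e. a family of primitive idempotents with $e_i\circ e_j=0$ for $i\ne j$ and $e_1+\dots+e_n=e$ (an idempotent is primitive if it is nonzero and not a sum of two nonzero idempotents). Let $V_+=\{x\circ x: x\in V\}$ be the symmetric cone of $V$, and for a nonempty set $S\subseteq V$ and $a\in V$ let $N_S(a)=\{d\in V:\langle d,x-a\rangle\le 0\text{ for all }x\in S\}$ be the normal cone of $S$ at $a$. Then for every $c\in V$ with $c\circ c=c$ and every $y\in V$, $$y\in N_{V_+}(c)\quad\Longleftrightarrow\quad -y\in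 V_+\ \text{ and }\ \langle y,c\rangle=0 .$$ -/

import Mathlib

/-- A Euclidean Jordan algebra: a finite-dimensional real commutative algebra with unit, whose
product (written `x * y`) satisfies the Jordan identity `(x * y) * (x * x) = x * (y * (x * x))`,
and which admits a positive definite symmetric bilinear form that is associative. The form is only
required to exist; the inner product used below is the trace inner product. -/
class EuclideanJordanAlgebra (V : Type*) [NonAssocCommRing V] [Module ℝ V] : Prop
    extends SMulCommClass ℝ V V, IsScalarTower ℝ V V, IsCommJordan V, Module.Finite ℝ V where
  exists_associative_form : ∃ B : LinearMap.BilinForm ℝ V,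
    (∀ x y, B x y = B y x) ∧ (∀ x, x ≠ 0 → 0 < B x x) ∧ (∀ x y z, B (x * y) z = B y (x * z))

namespace EuclideanJordanAlgebra

/-- A primitive idempotent: a nonzero idempotent that is not a sum of two nonzero idempotents. -/
structure IsPrimitiveIdempotent {V : Type*} [NonAssocCommRing V] (c : V) : Prop where
  isIdempotentElem : IsIdempotentElem c
  ne_zero : c ≠ 0
  not_add : ∀ a b : V, IsIdempotentElem a → IsIdempotentElem b → a ≠ 0 → b ≠ 0 → c ≠ a + b

/-- A Jordan frame: primitive idempotents `e 0, …, e (n-1)`, pairwise orthogonal, with sum `1`. -/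
structure IsJordanFrame {V : Type*} [NonAssocCommRing V] {n : ℕ} (e : Fin n → V) : Prop where
  primitive : ∀ i, IsPrimitiveIdempotent (e i)
  orthogonal : ∀ i j, i ≠ j → e i * e j = 0
  sum_eq_one : ∑ i, e i = 1

/-- `HasTrace x t`: there is a spectral decomposition `x = ∑ i, l i • e i` of `x` in a Jordan frame,
the sum of whose eigenvalues `l i` (with multiplicity) is `t`. -/
def HasTrace {V : Type*} [NonAssocCommRing V] [Module ℝ V] (x : V) (t : ℝ) : Prop :=
  ∃ (n : ℕ) (e : Fin n → V) (l : Fin n → ℝ),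
    IsJordanFrame e ∧ x = ∑ i, l i • e i ∧ t = ∑ i, l i

open Classical in
/-- The trace of `x`: the sum of the eigenvalues of `x`. In a Euclidean Jordan algebra every element
has a spectral decomposition and the eigenvalues are unique, so the default value is never used
and the choice does not matter. -/
noncomputable def trace {V : Type*} [NonAssocCommRing V] [Module ℝ V] (x : V) : ℝ :=
  if h : ∃ t, HasTrace x t then h.choose else 0

/-- The trace inner product `⟨x, y⟩ = tr (x ∘ y)`. -/
noncomputable def traceInner {V : Type*} [NonAssocCommRing V] [Module ℝ V] (x y : V) : ℝ :=
  trace (x * y)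

/-- The symmetric cone `V₊`: the set of squares. -/
def symmetricCone (V : Type*) [NonAssocCommRing V] : Set V :=
  {y | ∃ x : V, y = x * x}

/-- The normal cone of `S` at `a`: all `d` with `⟨d, x - a⟩ ≤ 0` for every `x ∈ S`. -/
def normalCone {V : Type*} [NonAssocCommRing V] [Module ℝ V] (S : Set V) (a : V) : Set V :=
  {d | ∀ x ∈ S, traceInner d (x - a) ≤ 0}

end EuclideanJordanAlgebra

open LinearMap (mulLeft)

/-! Testing the normal cone at `0` and `2 • c` gives `⟨y, c⟩ = 0`; testing it at the members of a
Jordan frame of `y` shows that every eigenvalue of `y` is nonpositive, so `-y` is a square. The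
converse is self-duality of the cone: squares are nonnegative combinations of primitive idempotents,
whose pairwise trace products are nonnegative.

The real work is the spectral theorem (`exists_isJordanFrame`) and the linearity of `trace`, which
is defined by a choice of decomposition. For linearity, `exists_linear_trace` represents the trace
as `B w` for an associative form `B`; this rests on `B c c = B d d` for non-orthogonal primitive
`c`, `d`. -/

/-- A symmetric operator for a positive definite bilinear form is diagonalizable, also on
invariant subspaces. -/
theorem LinearMap.BilinForm.mem_iSup_inf_eigenspace {V : Type*} [AddCommGroup V] [Module ℝ V]
    [Module.Finite ℝ V] (B : LinearMap.BilinForm ℝ V) (hsymm : ∀ x y, B x y = B y x)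
    (hpos : ∀ x, x ≠ 0 → 0 < B x x) (T : Module.End ℝ V) (hT : ∀ x y, B (T x) y = B x (T y))
    (W : Submodule ℝ V) (hW : ∀ x ∈ W, T x ∈ W) {v : V} (hv : v ∈ W) :
    v ∈ ⨆ μ : ℝ, W ⊓ T.eigenspace μ := by
  let core : InnerProductSpace.Core ℝ V :=
    { inner := fun x y => B x y
      conj_inner_symm := fun x y => hsymm y x
      re_inner_nonneg := fun x => by
        rcases eq_or_ne x 0 with rfl | h
        · simp
        · exact (hpos x h).le
      add_left := fun x y z => by simp
      smul_left := fun x y r => by simp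
      definite := fun x hx => by
        by_contra h
        exact (hpos x h).ne' hx }
  let _ : NormedAddCommGroup V := core.toNormedAddCommGroup
  let _ : InnerProductSpace ℝ V := InnerProductSpace.ofCore core.toCore
  have hTs : T.IsSymmetric := hT
  have htop : ⨆ μ : ℝ, T.genEigenspace μ 1 = ⊤ :=
    Submodule.orthogonal_eq_bot_iff.mp hTs.orthogonalComplement_iSup_eigenspaces_eq_bot
  have := Submodule.inf_iSup_genEigenspace hW 1
  rw [htop, inf_top_eq] at this
  exact this ▸ hv

/-! ### Commuting multiplication operators and the Peirce equation. -/

namespace EuclideanJordanAlgebra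

variable {V : Type*} [NonAssocCommRing V] [Module ℝ V] [EuclideanJordanAlgebra V]

/-- The full linearization of the Jordan identity. -/
theorem jordan_linearized (x z w y : V) :
    (x * y) * (z * w) + (z * y) * (x * w) + (w * y) * (x * z) =
      x * (y * (z * w)) + z * (y * (x * w)) + w * (y * (x * z)) := by
  have h (a : V) := IsCommJordan.lmul_comm_rmul_rmul a y
  have h1 := h (x + z + w)
  have h2 := h (x + z)
  have h3 := h (x + w)
  have h4 := h (z + w)
  have h5 := h x
  have h6 := h z
  have h7 := h w
  simp only [mul_add, add_mul, mul_comm w z, mul_comm w x, mul_comm z x] at h1 h2 h3 h4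
  -- Polarization of a cubic identity: the part linear in each of `x`, `z`, `w` contains every term
  -- twice.
  linear_combination (norm := module) (1 / 2 : ℝ) • (h1 - h2 - h3 - h4 + h5 + h6 + h7)

theorem commute_mulLeft_mulLeft_sq (x : V) : Commute (mulLeft ℝ x) (mulLeft ℝ (x * x)) := by
  ext u
  simp only [Module.End.mul_apply, LinearMap.mulLeft_apply]
  rw [mul_comm (x * x) u, ← IsCommJordan.lmul_comm_rmul_rmul, mul_comm]

theorem mulLeft_mul_sq (v x : V) :
    mulLeft ℝ (v * (x * x)) =
      (2 : ℝ) • (mulLeft ℝ (x * v) * mulLeft ℝ x) + mulLeft ℝ (x * x) * mulLeft ℝ v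
        - (2 : ℝ) • (mulLeft ℝ x * mulLeft ℝ v * mulLeft ℝ x) := by
  ext u
  have h := jordan_linearized x u x v
  simp only [LinearMap.sub_apply, LinearMap.add_apply, LinearMap.smul_apply, Module.End.mul_apply,
    LinearMap.mulLeft_apply]
  rw [mul_comm u x, mul_comm u v, mul_comm u (v * (x * x)), mul_comm (v * u) (x * x)] at h
  linear_combination (norm := module) -h

/-- The elements whose multiplication operator commutes with those of `x` and `x * x`. -/
def operatorCommutant (x : V) : Submodule ℝ V where
  carrier := {v | Commute (mulLeft ℝ v) (mulLeft ℝ x) ∧ Commute (mulLeft ℝ v) (mulLeft ℝ (x * x))}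
  zero_mem' := by simp
  add_mem' := fun {a b} ha hb => by
    have h : mulLeft ℝ (a + b) = mulLeft ℝ a + mulLeft ℝ b := by ext; simp [add_mul]
    simp only [Set.mem_ofPred_eq, h]
    exact ⟨ha.1.add_left hb.1, ha.2.add_left hb.2⟩
  smul_mem' := fun r a ha => by
    have h : mulLeft ℝ (r • a) = r • mulLeft ℝ a := by ext; exact smul_mul_assoc ..
    simp only [Set.mem_ofPred_eq, h]
    exact ⟨ha.1.smul_left r, ha.2.smul_left r⟩

theorem one_mem_operatorCommutant (x : V) : (1 : V) ∈ operatorCommutant x := by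
  have h : mulLeft ℝ (1 : V) = 1 := by ext; simp
  exact ⟨h ▸ Commute.one_left _, h ▸ Commute.one_left _⟩

/-- Makes the commutant an invariant subspace of `mulLeft ℝ x` containing `1`, which replaces power
associativity in the spectral theorem. -/
theorem mul_mem_operatorCommutant {x v : V} (hv : v ∈ operatorCommutant x) :
    x * v ∈ operatorCommutant x := by
  obtain ⟨h1, h2⟩ := hv
  have hx := commute_mulLeft_mulLeft_sq x
  have key1 : Commute (mulLeft ℝ (x * v)) (mulLeft ℝ x) := by
    ext u
    have h := jordan_linearized x x v u
    have h2u := LinearMap.congr_fun h2.eq u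
    simp only [Module.End.mul_apply, LinearMap.mulLeft_apply] at h2u ⊢
    rw [mul_comm (x * u), mul_comm u (x * v), mul_comm u (x * x), h2u,
      mul_comm (v * u) (x * x)] at h
    linear_combination (norm := module) (1 / 2 : ℝ) • h
  have key2 : Commute (mulLeft ℝ x) (mulLeft ℝ (v * (x * x))) := by
    rw [mulLeft_mul_sq]
    exact (((key1.symm.mul_right (Commute.refl _)).smul_right _).add_right
      (hx.mul_right h1.symm)).sub_right
      ((((Commute.refl _).mul_right h1.symm).mul_right (Commute.refl _)).smul_right _)
  have key3 : Commute (mulLeft ℝ v) (mulLeft ℝ (x * (x * x))) := by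
    rw [mulLeft_mul_sq]
    exact (((h2.mul_right h1).smul_right _).add_right (h2.mul_right h1)).sub_right
      (((h1.mul_right h1).mul_right h1).smul_right _)
  refine ⟨key1, ?_⟩
  ext u
  have h := jordan_linearized x v (x * x) u
  have h2u := LinearMap.congr_fun key2.eq u
  have h3u := LinearMap.congr_fun key3.eq u
  simp only [Module.End.mul_apply, LinearMap.mulLeft_apply] at h2u h3u ⊢
  rw [mul_comm (x * u), mul_comm (v * u), mul_comm (x * x * u), mul_comm u (v * (x * x)),
    mul_comm u (x * (x * x)), mul_comm u (x * v), h2u, h3u] at h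
  linear_combination (norm := module) h

/-- The Peirce equation of an idempotent. -/
theorem peirce {c : V} (hc : IsIdempotentElem c) (d : V) :
    (2 : ℝ) • (c * (c * (c * d))) - (3 : ℝ) • (c * (c * d)) + c * d = 0 := by
  have h := LinearMap.congr_fun (mulLeft_mul_sq c c) d
  simp only [LinearMap.sub_apply, LinearMap.add_apply, LinearMap.smul_apply, Module.End.mul_apply,
    LinearMap.mulLeft_apply, hc.eq] at h
  linear_combination (norm := module) h

end EuclideanJordanAlgebra

/-! ### Orthogonality of idempotents and the spectral theorem. -/

namespace EuclideanJordanAlgebra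

variable {V : Type*} [NonAssocCommRing V] [Module ℝ V]

/-- A positive definite symmetric associative bilinear form. -/
structure IsAssociativeForm (B : LinearMap.BilinForm ℝ V) : Prop where
  symm : ∀ x y, B x y = B y x
  pos : ∀ x, x ≠ 0 → 0 < B x x
  assoc : ∀ x y z, B (x * y) z = B y (x * z)

/-- A finite family of pairwise orthogonal nonzero idempotents with sum `1` whose span
contains `x`. -/
structure IsSpectralFamily (x : V) (s : Finset V) : Prop where
  isIdempotentElem : ∀ v ∈ s, IsIdempotentElem v
  ne_zero : ∀ v ∈ s, v ≠ 0
  orthogonal : ∀ v ∈ s, ∀ u ∈ s, v ≠ u → v * u = 0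
  sum_eq_one : ∑ v ∈ s, v = 1
  exists_coeff : ∃ l : V → ℝ, x = ∑ v ∈ s, l v • v

variable {B : LinearMap.BilinForm ℝ V}

theorem IsAssociativeForm.nonneg (hB : IsAssociativeForm B) (x : V) : 0 ≤ B x x := by
  rcases eq_or_ne x 0 with rfl | h
  · simp
  · exact (hB.pos x h).le

theorem IsAssociativeForm.apply_idempotent (hB : IsAssociativeForm B) {c : V} (d : V)
    (hc : IsIdempotentElem c) : B c (c * d) = B c d := by
  rw [← hB.assoc, hB.symm, hc.eq, hB.symm]

theorem IsAssociativeForm.apply_eq_zero_of_mul_eq_zero (hB : IsAssociativeForm B) {c d : V}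
    (hc : IsIdempotentElem c) (h : c * d = 0) : B c d = 0 := by
  rw [← hB.apply_idempotent d hc, h, map_zero]

theorem mul_eq_zero_of_isIdempotentElem_add {a b : V} (ha : IsIdempotentElem a)
    (hb : IsIdempotentElem b) (hab : IsIdempotentElem (a + b)) : a * b = 0 := by
  have h := hab.eq
  rw [mul_add, add_mul, add_mul, ha.eq, hb.eq, mul_comm b a] at h
  have h2 : (2 : ℝ) • (a * b) = 0 := by linear_combination (norm := module) h
  exact (smul_eq_zero.mp h2).resolve_left two_ne_zero

variable [EuclideanJordanAlgebra V]

theorem exists_isAssociativeForm :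
    ∃ B : LinearMap.BilinForm ℝ V, IsAssociativeForm B := by
  obtain ⟨B, h1, h2, h3⟩ := EuclideanJordanAlgebra.exists_associative_form (V := V)
  exact ⟨B, h1, h2, h3⟩

/-- Pair the Peirce equation with `d` and with `c * d`, then eliminate. As a sum of squares, `B c d`
is nonnegative, and it vanishes only if `c * d = 0`. -/
theorem IsAssociativeForm.apply_eq_add_of_isIdempotentElem (hB : IsAssociativeForm B) {c d : V}
    (hc : IsIdempotentElem c) (hd : IsIdempotentElem d) :
    B c d = B (c * d) (c * d) + 4 * B (c * d - c * (c * d)) (c * d - c * (c * d)) := by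
  have h0 : B d (c * d) = B c d := by
    rw [mul_comm, hB.apply_idempotent _ hd, hB.symm]
  have hp := peirce hc d
  set p := c * d with hpd
  set q := c * p with hqd
  have h1 := congrArg (B d) hp
  have h2 := congrArg (B p) hp
  have e1 : B d q = B p p := (hB.assoc c d p).symm
  have e2 : B d (c * q) = B p q := (hB.assoc c d q).symm
  have e3 : B p (c * q) = B q q := (hB.assoc c p q).symm
  have e4 : B q p = B p q := hB.symm _ _
  simp only [map_add, map_sub, map_smul, map_zero, smul_eq_mul, LinearMap.sub_apply] at h1 h2 ⊢
  linarith

theorem IsAssociativeForm.apply_nonneg_of_isIdempotentElem (hB : IsAssociativeForm B) {c d : V}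
    (hc : IsIdempotentElem c) (hd : IsIdempotentElem d) : 0 ≤ B c d := by
  rw [hB.apply_eq_add_of_isIdempotentElem hc hd]
  have := hB.nonneg (c * d)
  have := hB.nonneg (c * d - c * (c * d))
  positivity

theorem IsAssociativeForm.mul_eq_zero_of_apply_eq_zero (hB : IsAssociativeForm B) {c d : V}
    (hc : IsIdempotentElem c) (hd : IsIdempotentElem d) (h : B c d = 0) : c * d = 0 := by
  rw [hB.apply_eq_add_of_isIdempotentElem hc hd] at h
  by_contra hne
  have := hB.pos _ hne
  have := hB.nonneg (c * d - c * (c * d))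
  linarith

/-- The `f μ` are the components of `1` in the eigenspaces of `mulLeft ℝ x` within the commutant of
`x`. -/
theorem exists_spectral_finsupp (x : V) :
    ∃ f : ℝ →₀ V, (∀ μ, IsIdempotentElem (f μ)) ∧ (∀ μ ν, μ ≠ ν → f μ * f ν = 0) ∧
      (∑ μ ∈ f.support, f μ = 1) ∧ (∀ μ, x * f μ = μ • f μ) := by
  obtain ⟨B, hB⟩ := exists_isAssociativeForm (V := V)
  have h1 := B.mem_iSup_inf_eigenspace hB.symm hB.pos (LinearMap.mulLeft ℝ x)
    (fun y z => hB.assoc x y z) (operatorCommutant x)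
    (fun v hv => mul_mem_operatorCommutant hv) (one_mem_operatorCommutant x)
  obtain ⟨f, hf, hsum⟩ := (Submodule.mem_iSup_iff_exists_finsupp _ _).mp h1
  have hx (μ : ℝ) : x * f μ = μ • f μ := Module.End.mem_eigenspace_iff.mp (hf μ).2
  -- By commutation, `f μ * f ν` is an eigenvector for both `μ` and `ν`.
  have horth (μ ν : ℝ) (h : μ ≠ ν) : f μ * f ν = 0 := by
    have hc := LinearMap.congr_fun (hf μ).1.1.eq (f ν)
    have hc' := LinearMap.congr_fun (hf ν).1.1.eq (f μ)
    simp only [Module.End.mul_apply, LinearMap.mulLeft_apply, hx, mul_smul_comm] at hc hc'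
    rw [mul_comm (f ν), ← hc] at hc'
    have h0 : (ν - μ) • (f μ * f ν) = 0 := by rw [sub_smul, ← hc', sub_self]
    exact (smul_eq_zero.mp h0).resolve_left (sub_ne_zero.mpr h.symm)
  have hsum' : ∑ μ ∈ f.support, f μ = 1 := hsum
  refine ⟨f, fun μ => ?_, horth, hsum', hx⟩
  have h := congrArg (f μ * ·) hsum'
  simp only [Finset.mul_sum, mul_one] at h
  rw [Finset.sum_eq_single μ (fun ν _ hν => horth μ ν hν.symm) (fun hμ => by simp_all)] at h
  exact h

theorem mul_eq_zero_of_mul_add_eq_zero {a b c : V} (ha : IsIdempotentElem a)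
    (hb : IsIdempotentElem b) (hc : IsIdempotentElem c) (h : c * (a + b) = 0) : c * a = 0 := by
  obtain ⟨B, hB⟩ := exists_isAssociativeForm (V := V)
  have h0 := hB.apply_eq_zero_of_mul_eq_zero hc h
  rw [map_add] at h0
  have h1 := hB.apply_nonneg_of_isIdempotentElem hc ha
  have h2 := hB.apply_nonneg_of_isIdempotentElem hc hb
  exact hB.mul_eq_zero_of_apply_eq_zero hc ha (by linarith)

theorem exists_isSpectralFamily (x : V) : ∃ s : Finset V, IsSpectralFamily x s := by
  classical
  obtain ⟨f, hid, horth, hsum, hx⟩ := exists_spectral_finsupp x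
  have hinj : Set.InjOn f f.support := by
    intro μ hμ ν _ h
    by_contra hne
    have h0 := horth μ ν hne
    rw [← h, (hid μ).eq] at h0
    exact Finsupp.mem_support_iff.mp hμ h0
  refine ⟨f.support.image f, ?_, ?_, ?_, ?_, ?_⟩
  · simp only [Finset.mem_image]
    rintro _ ⟨μ, -, rfl⟩
    exact hid μ
  · simp only [Finset.mem_image]
    rintro _ ⟨μ, hμ, rfl⟩
    exact Finsupp.mem_support_iff.mp hμ
  · simp only [Finset.mem_image]
    rintro _ ⟨μ, -, rfl⟩ _ ⟨ν, -, rfl⟩ h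
    exact horth μ ν fun h' => h (h' ▸ rfl)
  · rw [Finset.sum_image hinj, hsum]
  · refine ⟨Function.invFunOn f f.support, ?_⟩
    rw [Finset.sum_image hinj]
    calc x = x * ∑ μ ∈ f.support, f μ := by rw [hsum, mul_one]
      _ = ∑ μ ∈ f.support, μ • f μ := by simp only [Finset.mul_sum, hx]
      _ = _ := Finset.sum_congr rfl fun μ hμ => by rw [hinj.leftInvOn_invFunOn hμ]

namespace IsSpectralFamily

variable {x : V} {s : Finset V}

theorem card_le_finrank (hs : IsSpectralFamily x s) : s.card ≤ Module.finrank ℝ V := by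
  have hli : LinearIndependent ℝ ((↑) : s → V) := by
    rw [Fintype.linearIndependent_iff]
    intro g hg u
    have h := congrArg ((u : V) * ·) hg
    simp only [Finset.mul_sum, mul_zero, mul_smul_comm] at h
    rw [Finset.sum_eq_single u (fun v _ hv => by
      rw [hs.orthogonal u u.2 v v.2 (fun h' => hv (Subtype.ext h'.symm)), smul_zero]) (by simp),
      (hs.isIdempotentElem u u.2).eq] at h
    exact (smul_eq_zero.mp h).resolve_right (hs.ne_zero u u.2)
  simpa using hli.fintype_card_le_finrank

theorem exists_card_lt (hs : IsSpectralFamily x s) {u : V} (hu : u ∈ s)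
    (hprim : ¬ IsPrimitiveIdempotent u) :
    ∃ t : Finset V, IsSpectralFamily x t ∧ s.card < t.card := by
  classical
  obtain ⟨a, b, ha, hb, ha0, hb0, rfl⟩ : ∃ a b : V, IsIdempotentElem a ∧ IsIdempotentElem b ∧
      a ≠ 0 ∧ b ≠ 0 ∧ u = a + b := by
    by_contra! h
    exact hprim ⟨hs.isIdempotentElem u hu, hs.ne_zero u hu, h⟩
  have hab := mul_eq_zero_of_isIdempotentElem_add ha hb (hs.isIdempotentElem _ hu)
  have hne : a ≠ b := by
    rintro rfl
    exact ha0 (ha.eq.symm.trans hab)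
  have hoa : ∀ v ∈ s.erase (a + b), v * a = 0 := fun v hv =>
    mul_eq_zero_of_mul_add_eq_zero ha hb (hs.isIdempotentElem v (Finset.mem_of_mem_erase hv))
      (hs.orthogonal v (Finset.mem_of_mem_erase hv) _ hu (Finset.ne_of_mem_erase hv))
  have hob : ∀ v ∈ s.erase (a + b), v * b = 0 := fun v hv =>
    mul_eq_zero_of_mul_add_eq_zero hb ha (hs.isIdempotentElem v (Finset.mem_of_mem_erase hv))
      (add_comm a b ▸
        hs.orthogonal v (Finset.mem_of_mem_erase hv) _ hu (Finset.ne_of_mem_erase hv))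
  have has : a ∉ s.erase (a + b) := fun h => ha0 (ha.eq.symm.trans (hoa a h))
  have hbs : b ∉ s.erase (a + b) := fun h => hb0 (hb.eq.symm.trans (hob b h))
  have has' : a ∉ insert b (s.erase (a + b)) := by simp [hne, has]
  obtain ⟨l, hl⟩ := hs.exists_coeff
  refine ⟨insert a (insert b (s.erase (a + b))), ⟨?_, ?_, ?_, ?_, ?_⟩, ?_⟩
  · simp only [Finset.mem_insert]
    rintro v (rfl | rfl | hv)
    exacts [ha, hb, hs.isIdempotentElem v (Finset.mem_of_mem_erase hv)]
  · simp only [Finset.mem_insert]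
    rintro v (rfl | rfl | hv)
    exacts [ha0, hb0, hs.ne_zero v (Finset.mem_of_mem_erase hv)]
  · simp only [Finset.mem_insert]
    rintro v (hv | hv | hv) w (hw | hw | hw) h
    · exact absurd (hv.trans hw.symm) h
    · rw [hv, hw, hab]
    · rw [hv, mul_comm, hoa w hw]
    · rw [hv, hw, mul_comm, hab]
    · exact absurd (hv.trans hw.symm) h
    · rw [hv, mul_comm, hob w hw]
    · rw [hw, hoa v hv]
    · rw [hw, hob v hv]
    · exact hs.orthogonal v (Finset.mem_of_mem_erase hv) w (Finset.mem_of_mem_erase hw) h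
  · rw [Finset.sum_insert has', Finset.sum_insert hbs, ← add_assoc, Finset.add_sum_erase s (fun v => v) hu,
      hs.sum_eq_one]
  · refine ⟨fun v => if v = a ∨ v = b then l (a + b) else l v, ?_⟩
    rw [Finset.sum_insert has', Finset.sum_insert hbs, ← add_assoc]
    simp only [true_or, or_true, if_true, ← smul_add]
    rw [hl, ← Finset.add_sum_erase s _ hu]
    congr 1
    refine Finset.sum_congr rfl fun v hv => ?_
    rw [if_neg]
    rintro (rfl | rfl)
    exacts [has hv, hbs hv]
  · rw [Finset.card_insert_of_notMem has', Finset.card_insert_of_notMem hbs,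
      Finset.card_erase_add_one hu]
    exact Nat.lt_succ_self _

/-- Splitting non-primitive members must stop, since the cardinality is bounded by the dimension. -/
theorem exists_isPrimitiveIdempotent (hs : IsSpectralFamily x s) :
    ∃ t : Finset V, IsSpectralFamily x t ∧ ∀ u ∈ t, IsPrimitiveIdempotent u := by
  induction h : Module.finrank ℝ V - s.card using Nat.strong_induction_on generalizing s with
  | _ k ih =>
    by_cases hp : ∀ u ∈ s, IsPrimitiveIdempotent u
    · exact ⟨s, hs, hp⟩
    · push Not at hp
      obtain ⟨u, hu, hpu⟩ := hp
      obtain ⟨t, ht, hst⟩ := hs.exists_card_lt hu hpu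
      have := ht.card_le_finrank
      exact ih _ (by omega) ht rfl

end IsSpectralFamily

/-- The spectral theorem. -/
theorem exists_isJordanFrame (x : V) :
    ∃ (n : ℕ) (e : Fin n → V) (l : Fin n → ℝ), IsJordanFrame e ∧ x = ∑ i, l i • e i := by
  obtain ⟨s, hs⟩ := exists_isSpectralFamily x
  obtain ⟨t, ht, hp⟩ := hs.exists_isPrimitiveIdempotent
  obtain ⟨l, hl⟩ := ht.exists_coeff
  let φ := t.equivFin.symm
  refine ⟨t.card, fun i => φ i, fun i => l (φ i), ⟨fun i => hp _ (φ i).2, fun i j hij => ?_, ?_⟩, ?_⟩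
  · exact ht.orthogonal _ (φ i).2 _ (φ j).2 fun h => hij (φ.injective (Subtype.ext h))
  · rw [φ.sum_comp (fun v : t => (v : V)), Finset.sum_coe_sort t (fun v => v), ht.sum_eq_one]
  · rw [φ.sum_comp (fun v : t => l v • (v : V)), Finset.sum_coe_sort t (fun v => l v • v), hl]

end EuclideanJordanAlgebra

/-! ### Primitive idempotents and linearity of the trace. -/

namespace EuclideanJordanAlgebra

variable {V : Type*} [NonAssocCommRing V] [Module ℝ V] [EuclideanJordanAlgebra V]
  {B : LinearMap.BilinForm ℝ V}

/-- Since `x * x` is `B`-orthogonal to `1 - c`, so is each spectral idempotent of `x` with nonzero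
eigenvalue; it then lies below `c`, and primitivity makes it equal to `c`. -/
theorem IsPrimitiveIdempotent.exists_eq_smul {c : V} (hc : IsPrimitiveIdempotent c) {x : V}
    (hx : c * x = x) : ∃ r : ℝ, x = r • c := by
  obtain ⟨B, hB⟩ := exists_isAssociativeForm (V := V)
  obtain ⟨f, hid, horth, hsum, hf⟩ := exists_spectral_finsupp x
  have hci := hc.isIdempotentElem
  have hc1 : IsIdempotentElem (1 - c) := by
    simp [IsIdempotentElem, mul_sub, sub_mul, hci.eq]
  have hxs : x = ∑ μ ∈ f.support, μ • f μ := by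
    calc x = x * ∑ μ ∈ f.support, f μ := by rw [hsum, mul_one]
      _ = _ := by simp only [Finset.mul_sum, hf]
  have hxx : x * x = ∑ μ ∈ f.support, (μ * μ) • f μ :=
    (congrArg (x * ·) hxs).trans (by simp only [Finset.mul_sum, mul_smul_comm, hf, smul_smul])
  have hzero : B (x * x) (1 - c) = 0 := by
    rw [hB.assoc, mul_sub, mul_one, mul_comm x c, hx, sub_self, map_zero]
  have hnn : ∀ μ ∈ f.support, 0 ≤ μ * μ * B (f μ) (1 - c) := fun μ _ =>
    mul_nonneg (mul_self_nonneg μ) (hB.apply_nonneg_of_isIdempotentElem (hid μ) hc1)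
  simp only [hxx, map_sum, map_smul, LinearMap.sum_apply, LinearMap.smul_apply,
    smul_eq_mul] at hzero
  rw [Finset.sum_eq_zero_iff_of_nonneg hnn] at hzero
  -- Each term with `μ ≠ 0` will be `μ • c`, and `μ = 0` contributes nothing.
  refine ⟨∑ μ ∈ f.support, μ, ?_⟩
  rw [hxs, Finset.sum_smul]
  refine Finset.sum_congr rfl fun μ hμ => ?_
  rcases eq_or_ne μ 0 with rfl | hμ0
  · simp
  have hm := hB.mul_eq_zero_of_apply_eq_zero (hid μ) hc1
    ((mul_eq_zero.mp (hzero μ hμ)).resolve_left (mul_self_ne_zero.mpr hμ0))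
  rw [mul_sub, mul_one, sub_eq_zero] at hm
  have hd : IsIdempotentElem (c - f μ) := by
    simp [IsIdempotentElem, mul_sub, sub_mul, hci.eq, (hid μ).eq, ← hm, mul_comm c (f μ)]
  by_contra hne
  have hcf : f μ ≠ c := fun h => hne (by rw [h])
  exact hc.not_add (f μ) (c - f μ) (hid μ) hd (Finsupp.mem_support_iff.mp hμ)
    (sub_ne_zero.mpr hcf.symm) (add_sub_cancel _ _).symm

/-- `B (c * d) (c * d)` in terms of `B c c` and `B c d`, for a primitive idempotent `c`. -/
theorem IsPrimitiveIdempotent.apply_mul_mul (hB : IsAssociativeForm B) {c d : V}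
    (hc : IsPrimitiveIdempotent c) (hd : IsIdempotentElem d) :
    2 * B (c * d) (c * d) * B c c = (B c c + B c d) * B c d := by
  have hci := hc.isIdempotentElem
  -- The Peirce polynomial is `t(2t - 1)(t - 1)`, so `t(2t - 1)` maps `d` into the `1`-eigenspace of
  -- `c`, which is `ℝ c`.
  have hfix : c * ((2 : ℝ) • (c * (c * d)) - c * d) = (2 : ℝ) • (c * (c * d)) - c * d := by
    rw [mul_sub, mul_smul_comm]
    linear_combination (norm := module) peirce hci d
  obtain ⟨r, hr⟩ := hc.exists_eq_smul hfix
  have h1 := congrArg (B c) hr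
  have h2 := congrArg (B d) hr
  have e1 : B d (c * (c * d)) = B (c * d) (c * d) := (hB.assoc c d _).symm
  have e2 : B d (c * d) = B c d := by
    rw [mul_comm, hB.apply_idempotent _ hd, hB.symm]
  simp only [map_sub, map_smul, smul_eq_mul, hB.apply_idempotent _ hci] at h1 h2
  rw [e1, e2, hB.symm d c] at h2
  linear_combination B c c * h2 - B c d * h1

/-- `B (c * d) (c * d)` is symmetric in `c` and `d`; compare its two expressions. -/
theorem IsPrimitiveIdempotent.apply_self_eq (hB : IsAssociativeForm B) {c d : V}
    (hc : IsPrimitiveIdempotent c) (hd : IsPrimitiveIdempotent d) (h : B c d ≠ 0) :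
    B c c = B d d := by
  have h1 := hc.apply_mul_mul hB hd.isIdempotentElem
  have h2 := hd.apply_mul_mul hB hc.isIdempotentElem
  rw [mul_comm d c, hB.symm d c] at h2
  refine mul_left_cancel₀ (mul_ne_zero h h) ?_
  linear_combination B d d * h1 - B c c * h2

/-- The trace is represented by some `w`: `B w` takes the value `1` on every primitive
idempotent, and `B w (c * d) = B c d / B c c` whenever `c` is primitive. -/
theorem exists_trace_representative (hB : IsAssociativeForm B) :
    ∃ w : V, ∀ c : V, IsPrimitiveIdempotent c →
      B w c = 1 ∧ ∀ d : V, B w (c * d) = (B c c)⁻¹ * B c d := by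
  obtain ⟨n, e, -, he, -⟩ := exists_isJordanFrame (1 : V)
  refine ⟨∑ i, (B (e i) (e i))⁻¹ • e i, fun c hc => ?_⟩
  -- Only the `e i` not orthogonal to `c` contribute, and for these the weight is `(B c c)⁻¹`.
  have hw : c * ∑ i, (B (e i) (e i))⁻¹ • e i = (B c c)⁻¹ • c := by
    calc c * ∑ i, (B (e i) (e i))⁻¹ • e i = ∑ i, (B c c)⁻¹ • (c * e i) := by
          simp only [Finset.mul_sum, mul_smul_comm]
          refine Finset.sum_congr rfl fun i _ => ?_
          by_cases h : B c (e i) = 0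
          · rw [hB.mul_eq_zero_of_apply_eq_zero hc.isIdempotentElem
              (he.primitive i).isIdempotentElem h, smul_zero, smul_zero]
          · rw [hc.apply_self_eq hB (he.primitive i) h]
      _ = _ := by rw [← Finset.smul_sum, ← Finset.mul_sum, he.sum_eq_one, mul_one]
  have key (d : V) : B (∑ i, (B (e i) (e i))⁻¹ • e i) (c * d) = (B c c)⁻¹ * B c d := by
    rw [← hB.assoc, hw, map_smul, LinearMap.smul_apply, smul_eq_mul]
  refine ⟨?_, key⟩
  have h := key c
  rwa [hc.isIdempotentElem.eq, inv_mul_cancel₀ (hB.pos c hc.ne_zero).ne'] at h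

/-- The trace is a linear functional, equal to `1` on primitive idempotents and nonnegative on
products of primitive idempotents. -/
theorem exists_linear_trace :
    ∃ τ : V →ₗ[ℝ] ℝ, (∀ x, trace x = τ x) ∧ (∀ c, IsPrimitiveIdempotent c → τ c = 1) ∧
      ∀ c d, IsPrimitiveIdempotent c → IsPrimitiveIdempotent d → 0 ≤ τ (c * d) := by
  obtain ⟨B, hB⟩ := exists_isAssociativeForm (V := V)
  obtain ⟨w, hw⟩ := exists_trace_representative hB
  refine ⟨B w, fun x => ?_, fun c hc => (hw c hc).1, fun c d hc hd => ?_⟩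
  · have hex : ∃ t, HasTrace x t := by
      obtain ⟨n, e, l, he, hx⟩ := exists_isJordanFrame x
      exact ⟨_, n, e, l, he, hx, rfl⟩
    rw [trace, dif_pos hex]
    -- Every decomposition gives the value `B w x`, so the chosen one does too.
    obtain ⟨n, e, l, he, hx, ht⟩ := hex.choose_spec
    rw [ht, hx, map_sum]
    exact Finset.sum_congr rfl fun i _ => by
      rw [map_smul, (hw _ (he.primitive i)).1, smul_eq_mul, mul_one]
  · rw [(hw c hc).2]
    exact mul_nonneg (inv_nonneg.mpr (hB.nonneg c))
      (hB.apply_nonneg_of_isIdempotentElem hc.isIdempotentElem hd.isIdempotentElem)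

theorem IsJordanFrame.mul_self_sum {n : ℕ} {e : Fin n → V} (he : IsJordanFrame e)
    (l : Fin n → ℝ) : (∑ i, l i • e i) * (∑ i, l i • e i) = ∑ i, (l i * l i) • e i := by
  rw [Finset.sum_mul]
  refine Finset.sum_congr rfl fun i _ => ?_
  rw [Finset.mul_sum, Finset.sum_eq_single i]
  · rw [smul_mul_smul_comm, (he.primitive i).isIdempotentElem.eq]
  · intro j _ hj
    rw [smul_mul_smul_comm, he.orthogonal i j hj.symm, smul_zero]
  · simp

end EuclideanJordanAlgebra

open EuclideanJordanAlgebra in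
theorem mainTheorem4 {V : Type*} [NonAssocCommRing V] [Module ℝ V] [EuclideanJordanAlgebra V]
    (c : V) (hc : IsIdempotentElem c) (y : V) :
    y ∈ EuclideanJordanAlgebra.normalCone (EuclideanJordanAlgebra.symmetricCone V) c ↔
      -y ∈ EuclideanJordanAlgebra.symmetricCone V ∧
        EuclideanJordanAlgebra.traceInner y c = 0 := by
  obtain ⟨τ, hτ, hτ1, hτnn⟩ := exists_linear_trace (V := V)
  simp only [normalCone, symmetricCone, traceInner, Set.mem_ofPred_eq, hτ]
  constructor
  · intro h
    have hyc : τ (y * c) = 0 := by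
      -- The points `0` and `2 • c` lie on either side of `c` on its ray, giving opposite
      -- inequalities.
      have h0 := h 0 ⟨0, by simp⟩
      have h2 := h ((2 : ℝ) • c) ⟨Real.sqrt 2 • c, by
        rw [smul_mul_smul_comm, hc.eq, Real.mul_self_sqrt zero_le_two]⟩
      simp only [mul_sub, mul_zero, mul_smul_comm, map_sub, map_smul, map_zero,
        smul_eq_mul] at h0 h2
      linarith
    refine ⟨?_, hyc⟩
    obtain ⟨n, e, l, he, hy⟩ := exists_isJordanFrame y
    have hl (i : Fin n) : l i ≤ 0 := by
      have hi := h (e i) ⟨e i, (he.primitive i).isIdempotentElem.eq.symm⟩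
      have hye : y * e i = l i • e i := by
        rw [hy, Finset.sum_mul, Finset.sum_eq_single i]
        · rw [smul_mul_assoc, (he.primitive i).isIdempotentElem.eq]
        · intro j _ hj
          rw [smul_mul_assoc, he.orthogonal j i hj, smul_zero]
        · simp
      rw [mul_sub, map_sub, hyc, sub_zero, hye, map_smul, hτ1 _ (he.primitive i), smul_eq_mul,
        mul_one] at hi
      exact hi
    refine ⟨∑ i, Real.sqrt (-l i) • e i, ?_⟩
    rw [he.mul_self_sum, hy, ← Finset.sum_neg_distrib]
    refine Finset.sum_congr rfl fun i _ => ?_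
    rw [Real.mul_self_sqrt (neg_nonneg.mpr (hl i)), neg_smul]
  · rintro ⟨⟨u, hu⟩, hyc⟩ _ ⟨v, rfl⟩
    rw [mul_sub, map_sub, hyc, sub_zero]
    obtain ⟨n, e, l, he, rfl⟩ := exists_isJordanFrame u
    obtain ⟨m, f, k, hf, rfl⟩ := exists_isJordanFrame v
    rw [he.mul_self_sum] at hu
    rw [hf.mul_self_sum, ← neg_neg y, hu, neg_mul, map_neg, neg_nonpos, Finset.sum_mul, map_sum]
    refine Finset.sum_nonneg fun i _ => ?_
    rw [Finset.mul_sum, map_sum]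
    refine Finset.sum_nonneg fun j _ => ?_
    rw [smul_mul_smul_comm, map_smul, smul_eq_mul]
    exact mul_nonneg (mul_nonneg (mul_self_nonneg _) (mul_self_nonneg _))
      (hτnn _ _ (he.primitive i) (hf.primitive j))
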